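/- Let $K$ be a geometric simplicial complex in a Euclidean space $\mathbb{R}^d$ (for planar shapes, $d=2$). A \emph{shape nerve} of $K$ with nucleus $p$ is a nonempty collection $N$ of $2$-simplexes (filled triangles) of $K$ that all have the vertex $p$ in common; its region $|N|\subseteq\mathbb{R}^d$ is the union of its closed triangles. The \emph{nerve} of a finite family $(U_i)_{i\in I}$ of sets is the abstract simplicial complex on $I$ whose simplexes are the nonempty $\sigma\subseteq I$ with $\bigcap_{i\in\sigma}U_i\neq\emptyset$; as a topological space it is understood as its geometric realization. Let $(N_i)_{i\in I}$ be a finite family of shape nerves of $K$, with nuclei $(p_i)_{i\in I}$, whose regions $|N_i|$ are closed convex subsets of $\mathbb{R}^d$, and let the shape $\mathrm{sh}\,A$ be the nerve of the family $(|N_i|)_{i\in I}$. Then $\mathrm{sh}\,A$ and the union $\bigcup_{i\in I}|N_i|$ of the shape nerves (with the subspace topology from $\mathbb{R}^d$) have the same homotopy type, i.e. they are homotopy equivalent. (In particular this holds when all the shape nerves $|N_i|$, $i\in I$, have a point in common.) -/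

import Mathlib

open scoped ContinuousMap

namespace ShapeNerve

/-- `N` is a shape nerve of the geometric simplicial complex `K` with nucleus `p`: a nonempty
collection of 2-simplexes (filled triangles, recorded by their three vertices) of `K` that all
have the vertex `p` in common. The collection need not contain all triangles of `K` at `p`. -/
structure IsShapeNerve {d : ℕ} (K : Geometry.SimplicialComplex ℝ (EuclideanSpace ℝ (Fin d)))
    (p : EuclideanSpace ℝ (Fin d)) (N : Set (Finset (EuclideanSpace ℝ (Fin d)))) : Prop where
  nonempty : N.Nonempty
  mem_faces : ∀ s ∈ N, s ∈ K.faces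
  card_eq : ∀ s ∈ N, s.card = 3
  nucleus_mem : ∀ s ∈ N, p ∈ s

/-- The region of Euclidean space occupied by a collection of simplexes: the union of the closed
simplexes, i.e. of the convex hulls of the vertex sets. -/
def region {d : ℕ} (N : Set (Finset (EuclideanSpace ℝ (Fin d)))) :
    Set (EuclideanSpace ℝ (Fin d)) :=
  ⋃ s ∈ N, convexHull ℝ (s : Set (EuclideanSpace ℝ (Fin d)))

/-- The (Edelsbrunner-Harer) nerve of a family of sets: the abstract simplicial complex of all
nonempty finite subfamilies whose members have nonempty common intersection. -/
def nerve {ι X : Type*} (U : ι → Set X) : PreAbstractSimplicialComplex ι where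
  faces := {s | s.Nonempty ∧ (⋂ i ∈ s, U i).Nonempty}
  isRelLowerSet_faces := fun _ hs =>
    ⟨hs.1, fun _ hts ht => ⟨ht, hs.2.mono (Set.biInter_subset_biInter_left hts)⟩⟩

/-- The geometric realization of an abstract simplicial complex with vertices in a finite type `ι`:
the points of the standard simplex, in barycentric coordinates, whose nonzero coordinates all
belong to one face. It carries the subspace topology from `ι → ℝ`. -/
def realization {ι : Type*} [Fintype ι] (L : PreAbstractSimplicialComplex ι) : Set (ι → ℝ) :=
  {t | t ∈ stdSimplex ℝ ι ∧ ∃ s ∈ L.faces, ∀ i, t i ≠ 0 → i ∈ s}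

/-- The shape defined by a finite family of shape nerves: (the geometric realization of) the nerve
of the regions that the members of the family occupy. -/
def shape {ι : Type*} [Fintype ι] {d : ℕ}
    (N : ι → Set (Finset (EuclideanSpace ℝ (Fin d)))) : Set (ι → ℝ) :=
  realization (nerve fun i => region (N i))

end ShapeNerve

/-!
The theorem is the nerve theorem for a finite family of nonempty closed convex sets `U i` of a real
normed space, applied to the regions of the shape nerves. Two explicit maps are homotopy inverse to each
other, and both homotopies are made of straight segments. Write `n` for the number of sets and `X`
for their union, and fix the threshold `δ = 1 / (n + 1)`.

* `X → nerve`. By `exists_bump` there are functions `h i` with values in `[0, 1]`, equal to `1` on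
  `U i`, such that the sets `U i` with `h i x ≠ 0` always have a common point. Dividing by
  `∑ j, h j` gives barycentric coordinates `f x` of a point of the nerve, with `1 / n ≤ f x i`
  whenever `x ∈ U i`.
* `nerve → X`. By `exists_realization_map` there is a continuous `g` with `g t ∈ U i` whenever
  `δ ≤ t i`. Some coordinate of `t` is at least `1 / n`, so `g t` lies in `X`.

If `x ∈ U i`, then `f x i ≥ 1 / n`, hence `g (f x) ∈ U i`, and the segment from `x` to `g (f x)`
stays in the convex set `U i`. For the other composition, let `m t` be obtained from `t` by
replacing each `t i` with `max 0 (t i - δ)` and renormalizing. The support of `m t` is contained in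
that of `t`, so the segment from `m t` to `t` stays in the nerve. If `m t i ≠ 0`, then
`g t ∈ U i`, hence `f (g t) i ≠ 0`; so the support of `m t` is also contained in that of `f (g t)`,
and the segment from `f (g t)` to `m t` stays in the nerve as well.
-/

namespace ShapeNerve

/-! ### Straight-line homotopies and barycentric coordinates -/

theorem homotopic_of_segment_subset {X E : Type*} [TopologicalSpace X] [AddCommGroup E]
    [Module ℝ E] [TopologicalSpace E] [IsTopologicalAddGroup E] [ContinuousSMul ℝ E]
    {S : Set E} (f g : C(X, S)) (h : ∀ x, segment ℝ (f x : E) (g x : E) ⊆ S) :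
    f.Homotopic g := by
  refine ⟨⟨⟨fun q => ⟨AffineMap.lineMap (f q.2 : E) (g q.2 : E) (q.1 : ℝ), h q.2 ?_⟩, ?_⟩,
    ?_, ?_⟩⟩
  · rw [segment_eq_image_lineMap]
    exact ⟨q.1, q.1.2, rfl⟩
  · refine Continuous.subtype_mk ?_ _
    simp only [AffineMap.lineMap_apply_module]
    fun_prop
  · intro x
    simp
  · intro x
    simp

theorem div_sum_mem_stdSimplex {ι : Type*} [Fintype ι] {w : ι → ℝ} (h0 : ∀ i, 0 ≤ w i)
    (hpos : 0 < ∑ i, w i) : (fun i => w i / ∑ j, w j) ∈ stdSimplex ℝ ι :=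
  ⟨fun i => div_nonneg (h0 i) hpos.le, by rw [← Finset.sum_div, div_self hpos.ne']⟩

theorem exists_inv_card_le_of_mem_stdSimplex {ι : Type*} [Fintype ι] {t : ι → ℝ}
    (ht : t ∈ stdSimplex ℝ ι) : ∃ i, ((Fintype.card ι : ℝ))⁻¹ ≤ t i := by
  have hne : (Finset.univ : Finset ι).Nonempty := by
    by_contra hcon
    have h1 := ht.2
    rw [Finset.not_nonempty_iff_eq_empty.1 hcon] at h1
    simp at h1
  obtain ⟨i, -, hi⟩ := Finset.exists_le_of_sum_le (s := Finset.univ)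
    (f := fun _ : ι => ((Fintype.card ι : ℝ))⁻¹) (g := t) hne (by
      have hc : (Fintype.card ι : ℝ) ≠ 0 := by
        exact_mod_cast (Finset.card_pos.2 hne).ne'
      rw [ht.2]
      simp [hc])
  exact ⟨i, hi⟩

/-- A point of the realized nerve is a point of the standard simplex for which the sets with nonzero
coordinate have a common point. -/
theorem mem_realization_nerve {ι X : Type*} [Fintype ι] {U : ι → Set X} {t : ι → ℝ} :
    t ∈ realization (nerve U) ↔ t ∈ stdSimplex ℝ ι ∧ ∃ x, ∀ i, t i ≠ 0 → x ∈ U i := by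
  classical
  refine and_congr_right fun ht => ⟨?_, ?_⟩
  · rintro ⟨s, ⟨-, x, hx⟩, hs⟩
    exact ⟨x, fun i hi => Set.mem_iInter₂.1 hx i (hs i hi)⟩
  · rintro ⟨x, hx⟩
    refine ⟨Finset.univ.filter fun i => t i ≠ 0, ⟨?_, x, ?_⟩, by simp⟩
    · by_contra hcon
      have h0 : ∀ i, t i = 0 := by
        simpa [Finset.filter_eq_empty_iff] using hcon
      have h1 := ht.2
      simp [h0] at h1
    · simpa using hx

/-- A segment lies in the realized nerve as soon as all sets with a nonzero coordinate at one of
its ends have a common point. -/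
theorem segment_subset_realization_nerve {ι X : Type*} [Fintype ι] {U : ι → Set X}
    {s t : ι → ℝ} (hs : s ∈ stdSimplex ℝ ι) (ht : t ∈ stdSimplex ℝ ι)
    (h : ∃ x, ∀ i, s i ≠ 0 ∨ t i ≠ 0 → x ∈ U i) :
    segment ℝ s t ⊆ realization (nerve U) := by
  obtain ⟨x, hx⟩ := h
  intro u hu
  refine mem_realization_nerve.2 ⟨(convex_stdSimplex ℝ ι).segment_subset hs ht hu, x, ?_⟩
  obtain ⟨a, b, -, -, -, rfl⟩ := hu
  intro i hi
  refine hx i ?_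
  by_contra! hcon
  simp [hcon.1, hcon.2] at hi

/-! ### From the union to the nerve -/

/-- Bump functions for a finite family of closed sets whose supports create no new intersections.
For every subfamily `s` with empty intersection, the sum over `j ∈ s` of the distances to `U j` is
positive, and the factor `max 0 (1 - |s| * dist(x, U i) / ∑ j ∈ s, dist(x, U j))` vanishes for the
`i ∈ s` whose distance is at least the average. The bump function of `U i` is the product of these
factors over all such `s` that contain `i`. -/
theorem exists_bump {ι X : Type*} [Fintype ι] [PseudoMetricSpace X] {U : ι → Set X}
    (hne : ∀ i, (U i).Nonempty) (hclosed : ∀ i, IsClosed (U i)) :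
    ∃ h : ι → X → ℝ, (∀ i, Continuous (h i)) ∧ (∀ i x, 0 ≤ h i x) ∧ (∀ i x, h i x ≤ 1) ∧
      (∀ i, ∀ x ∈ U i, h i x = 1) ∧ ∀ x, ∃ y, ∀ i, h i x ≠ 0 → y ∈ U i := by
  classical
  let D : Finset ι → X → ℝ := fun s x => ∑ j ∈ s, Metric.infDist x (U j)
  let F : Finset ι → ι → X → ℝ := fun s i x =>
    max 0 (1 - s.card * Metric.infDist x (U i) / D s x)
  let B : ι → Finset (Finset ι) := fun i =>
    Finset.univ.filter fun s => i ∈ s ∧ ¬ (⋂ j ∈ s, U j).Nonempty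
  have hDpos : ∀ s : Finset ι, ¬ (⋂ j ∈ s, U j).Nonempty → ∀ x, 0 < D s x := by
    intro s hs x
    refine lt_of_le_of_ne (Finset.sum_nonneg fun _ _ => Metric.infDist_nonneg) fun h0 => hs ⟨x, ?_⟩
    have h1 := (Finset.sum_eq_zero_iff_of_nonneg fun _ _ => Metric.infDist_nonneg).1 h0.symm
    exact Set.mem_iInter₂.2 fun j hj => ((hclosed j).mem_iff_infDist_zero (hne j)).2 (h1 j hj)
  have hB : ∀ {i s}, s ∈ B i ↔ i ∈ s ∧ ¬ (⋂ j ∈ s, U j).Nonempty := by simp [B]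
  refine ⟨fun i x => ∏ s ∈ B i, F s i x, fun i => ?_, fun i x => ?_, fun i x => ?_,
    fun i x hx => ?_, fun x => ?_⟩
  · refine continuous_finsetProd _ fun s hs => continuous_const.max (continuous_const.sub ?_)
    refine Continuous.div (continuous_const.mul (Metric.continuous_infDist_pt _))
      (continuous_finsetSum _ fun j _ => Metric.continuous_infDist_pt _)
      fun x => (hDpos s (hB.1 hs).2 x).ne'
  · exact Finset.prod_nonneg fun s _ => le_max_left _ _
  · refine Finset.prod_le_one (fun s _ => le_max_left _ _) fun s hs => max_le zero_le_one ?_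
    have := (hDpos s (hB.1 hs).2 x).le
    have := Metric.infDist_nonneg (s := U i) (x := x)
    exact sub_le_self _ (by positivity)
  · refine Finset.prod_eq_one fun s _ => ?_
    simp [F, Metric.infDist_zero_of_mem hx]
  · by_contra! hcon
    let s : Finset ι := Finset.univ.filter fun i => ∏ s ∈ B i, F s i x ≠ 0
    have hs : ¬ (⋂ j ∈ s, U j).Nonempty := by
      rintro ⟨y, hy⟩
      obtain ⟨i, hi, hyi⟩ := hcon y
      exact hyi (Set.mem_iInter₂.1 hy i (by simpa [s] using hi))
    have hD := hDpos s hs x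
    -- Every factor is nonzero, so every distance is below the average of all the distances.
    have hlt : ∀ i ∈ s, s.card * Metric.infDist x (U i) < D s x := by
      intro i hi
      have h1 : ∏ s ∈ B i, F s i x ≠ 0 := (Finset.mem_filter.1 hi).2
      have h2 : F s i x ≠ 0 := Finset.prod_ne_zero_iff.1 h1 s (hB.2 ⟨hi, hs⟩)
      by_contra! hle
      refine h2 (max_eq_left ?_)
      have := (one_le_div hD).2 hle
      linarith
    have hsne : s.Nonempty := by
      by_contra he
      rw [Finset.not_nonempty_iff_eq_empty.1 he] at hD
      simp [D] at hD
    have hsum := Finset.sum_lt_sum_of_nonempty hsne hlt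
    rw [← Finset.mul_sum, Finset.sum_const, nsmul_eq_mul] at hsum
    exact lt_irrefl _ hsum

/-! ### From the nerve to the union -/

/-- A map out of the realized nerve that respects all sets of large coordinate. It is a weighted
mean of one chosen point `y s` in each nonempty intersection `⋂ i ∈ s, U i`, where the weight of
`s` vanishes unless `s` is contained in the support of `t` and contains all `i` with
`δ ≤ t i`. -/
theorem exists_realization_map {ι E : Type*} [Fintype ι] [AddCommGroup E] [Module ℝ E]
    [TopologicalSpace E] [IsTopologicalAddGroup E] [ContinuousSMul ℝ E] {U : ι → Set E}
    (hconvex : ∀ i, Convex ℝ (U i)) {δ : ℝ} (hδ : 0 < δ) :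
    ∃ g : realization (nerve U) → E, Continuous g ∧
      ∀ (t : realization (nerve U)) (i : ι), δ ≤ (t : ι → ℝ) i → g t ∈ U i := by
  classical
  have hy : ∀ s : Finset ι, ∃ y : E, (⋂ i ∈ s, U i).Nonempty → y ∈ ⋂ i ∈ s, U i := by
    intro s
    by_cases h : (⋂ i ∈ s, U i).Nonempty
    · exact ⟨h.choose, fun _ => h.choose_spec⟩
    · exact ⟨0, fun h' => absurd h' h⟩
  choose y hy using hy
  let c : Finset ι → (ι → ℝ) → ℝ := fun s t => (∏ i ∈ s, t i) * ∏ i ∈ sᶜ, max 0 (δ - t i)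
  have hc : ∀ s, Continuous (c s) := by
    intro s
    refine (continuous_finsetProd _ fun i _ => continuous_apply i).mul
      (continuous_finsetProd _ fun i _ => ?_)
    fun_prop
  have hc0 : ∀ (t : realization (nerve U)) s, 0 ≤ c s t := fun t s =>
    mul_nonneg (Finset.prod_nonneg fun i _ => t.2.1.1 i)
      (Finset.prod_nonneg fun i _ => le_max_left _ _)
  -- The support of `t` has positive weight.
  have hcpos : ∀ t : realization (nerve U), 0 < ∑ s, c s t := by
    intro t
    refine Finset.sum_pos' (fun s _ => hc0 t s)
      ⟨Finset.univ.filter fun i => (t : ι → ℝ) i ≠ 0, Finset.mem_univ _, ?_⟩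
    refine mul_pos (Finset.prod_pos fun i hi => ?_) (Finset.prod_pos fun i hi => ?_)
    · exact lt_of_le_of_ne (t.2.1.1 i) (Finset.mem_filter.1 hi).2.symm
    · have h0 : (t : ι → ℝ) i = 0 := by simpa using hi
      simp [h0, hδ]
  refine ⟨fun t => Finset.univ.centerMass (fun s => c s t) y, ?_, fun t i hi => ?_⟩
  · unfold Finset.centerMass
    refine Continuous.smul (Continuous.inv₀ ?_ fun t => (hcpos t).ne') ?_
    · exact continuous_finsetSum _ fun s _ => (hc s).comp continuous_subtype_val
    · exact continuous_finsetSum _ fun s _ =>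
        ((hc s).comp continuous_subtype_val).smul continuous_const
  · change Finset.univ.centerMass (fun s => c s t) y ∈ U i
    rw [← Finset.centerMass_filter_ne_zero]
    refine (hconvex i).centerMass_mem (fun s _ => hc0 t s) ?_ fun s hs => ?_
    · rw [Finset.sum_filter_ne_zero]
      exact hcpos t
    · obtain ⟨h1, h2⟩ := mul_ne_zero_iff.1 (Finset.mem_filter.1 hs).2
      have his : i ∈ s := by
        by_contra hcon
        exact Finset.prod_ne_zero_iff.1 h2 i (Finset.mem_compl.2 hcon)
          (max_eq_left (by linarith))
      obtain ⟨x, hx⟩ := (mem_realization_nerve.1 t.2).2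
      exact Set.mem_iInter₂.1 (hy s ⟨x, Set.mem_iInter₂.2 fun j hj =>
        hx j (Finset.prod_ne_zero_iff.1 h1 j hj)⟩) i his

/-! ### The nerve theorem -/

theorem nonempty_homotopyEquiv_realization_nerve {ι E : Type*} [Fintype ι]
    [NormedAddCommGroup E] [NormedSpace ℝ E] {U : ι → Set E} (hne : ∀ i, (U i).Nonempty)
    (hclosed : ∀ i, IsClosed (U i)) (hconvex : ∀ i, Convex ℝ (U i)) :
    Nonempty (realization (nerve U) ≃ₕ (⋃ i, U i : Set E)) := by
  obtain ⟨h, hcont, h0, h1, hU, hsupp⟩ := exists_bump hne hclosed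
  obtain ⟨δ, hδ⟩ : ∃ δ : ℝ, δ = ((Fintype.card ι : ℝ) + 1)⁻¹ := ⟨_, rfl⟩
  have hδ0 : 0 < δ := by
    rw [hδ]
    positivity
  have hδlt : ∀ _ : ι, δ < ((Fintype.card ι : ℝ))⁻¹ := by
    intro i
    have hpos : (0 : ℝ) < Fintype.card ι := by exact_mod_cast Fintype.card_pos_iff.2 ⟨i⟩
    rw [hδ]
    exact inv_strictAnti₀ hpos (by linarith)
  obtain ⟨g, hg, hgU⟩ := exists_realization_map hconvex hδ0
  have hlarge : ∀ t : realization (nerve U), ∃ i, δ < (t : ι → ℝ) i := by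
    intro t
    obtain ⟨i, hi⟩ := exists_inv_card_le_of_mem_stdSimplex t.2.1
    exact ⟨i, (hδlt i).trans_le hi⟩
  have hsum : ∀ x ∈ ⋃ i, U i, 0 < ∑ i, h i x := by
    intro x hx
    obtain ⟨i, hi⟩ := Set.mem_iUnion.1 hx
    exact Finset.sum_pos' (fun j _ => h0 j x) ⟨i, Finset.mem_univ _, by
      rw [hU i x hi]
      exact one_pos⟩
  -- The coordinates of the map to the nerve, and its values on each `U i`.
  let φ : E → ι → ℝ := fun x i => h i x / ∑ j, h j x
  have hφ : ∀ x ∈ ⋃ i, U i, φ x ∈ stdSimplex ℝ ι := fun x hx =>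
    div_sum_mem_stdSimplex (fun i => h0 i x) (hsum x hx)
  have hφsupp : ∀ x i, φ x i ≠ 0 → h i x ≠ 0 := fun x i hi => (div_ne_zero_iff.1 hi).1
  have hφU : ∀ i, ∀ x ∈ U i, δ ≤ φ x i := by
    intro i x hx
    refine (hδlt i).le.trans ?_
    have hle : ∑ j, h j x ≤ Fintype.card ι := by
      simpa using Finset.sum_le_sum fun j (_ : j ∈ Finset.univ) => h1 j x
    change _ ≤ h i x / _
    rw [hU i x hx, one_div]
    exact inv_anti₀ (hsum x (Set.mem_iUnion.2 ⟨i, hx⟩)) hle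
  let f : C((⋃ i, U i : Set E), realization (nerve U)) :=
    ⟨fun x => ⟨φ x, mem_realization_nerve.2 ⟨hφ x x.2, by
      obtain ⟨y, hy⟩ := hsupp x
      exact ⟨y, fun i hi => hy i (hφsupp x i hi)⟩⟩⟩, by
      refine Continuous.subtype_mk (continuous_pi fun i => Continuous.div ?_ ?_ ?_) _
      · exact (hcont i).comp continuous_subtype_val
      · exact continuous_finsetSum _ fun j _ => (hcont j).comp continuous_subtype_val
      · exact fun x => (hsum x x.2).ne'⟩
  have hgX : ∀ t, g t ∈ ⋃ i, U i := by
    intro t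
    obtain ⟨i, hi⟩ := hlarge t
    exact Set.mem_iUnion.2 ⟨i, hgU t i hi.le⟩
  let G : C(realization (nerve U), (⋃ i, U i : Set E)) :=
    ⟨fun t => ⟨g t, hgX t⟩, hg.subtype_mk hgX⟩
  -- The truncation that keeps only the coordinates above the threshold.
  let w : (ι → ℝ) → ι → ℝ := fun t i => max 0 (t i - δ)
  have hwpos : ∀ t : realization (nerve U), 0 < ∑ i, w t i := by
    intro t
    obtain ⟨i, hi⟩ := hlarge t
    exact Finset.sum_pos' (fun j _ => le_max_left _ _)
      ⟨i, Finset.mem_univ _, lt_max_of_lt_right (sub_pos.2 hi)⟩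
  let μ : (ι → ℝ) → ι → ℝ := fun t i => w t i / ∑ j, w t j
  have hμ : ∀ t : realization (nerve U), μ t ∈ stdSimplex ℝ ι := fun t =>
    div_sum_mem_stdSimplex (fun i => le_max_left _ _) (hwpos t)
  have hμsupp : ∀ t i, μ t i ≠ 0 → δ < t i := by
    intro t i hi
    by_contra! hcon
    exact (div_ne_zero_iff.1 hi).1 (max_eq_left (by linarith))
  have hμt : ∀ (t : realization (nerve U)),
      segment ℝ (μ t) (t : ι → ℝ) ⊆ realization (nerve U) := by
    intro t
    obtain ⟨x, hx⟩ := (mem_realization_nerve.1 t.2).2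
    refine segment_subset_realization_nerve (hμ t) t.2.1 ⟨x, fun i hi => hx i ?_⟩
    exact hi.elim (fun hi => (hδ0.trans (hμsupp t i hi)).ne') id
  let m : C(realization (nerve U), realization (nerve U)) :=
    ⟨fun t => ⟨μ t, hμt t (left_mem_segment ℝ _ _)⟩, by
      refine Continuous.subtype_mk (continuous_pi fun i => Continuous.div ?_ ?_ ?_) _
      · fun_prop
      · fun_prop
      · exact fun t => (hwpos t).ne'⟩
  refine ⟨⟨G, f, ?_, ?_⟩⟩
  · refine (homotopic_of_segment_subset (f.comp G) m fun t => ?_).trans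
      (homotopic_of_segment_subset m (ContinuousMap.id _) hμt)
    obtain ⟨y, hy⟩ := hsupp (g t)
    refine segment_subset_realization_nerve (hφ _ (G t).2) (hμ t) ⟨y, fun i hi => hy i ?_⟩
    refine hi.elim (hφsupp _ i) fun hi => ?_
    rw [hU i _ (hgU t i (hμsupp t i hi).le)]
    exact one_ne_zero
  · refine homotopic_of_segment_subset (G.comp f) (ContinuousMap.id _) fun x => ?_
    obtain ⟨i, hi⟩ := Set.mem_iUnion.1 x.2
    exact ((hconvex i).segment_subset (hgU (f x) i (hφU i x hi)) hi).trans
      (Set.subset_iUnion U i)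

theorem IsShapeNerve.region_nonempty {d : ℕ}
    {K : Geometry.SimplicialComplex ℝ (EuclideanSpace ℝ (Fin d))}
    {p : EuclideanSpace ℝ (Fin d)} {N : Set (Finset (EuclideanSpace ℝ (Fin d)))}
    (hN : IsShapeNerve K p N) : (region N).Nonempty := by
  obtain ⟨s, hs⟩ := hN.nonempty
  exact ⟨p, Set.mem_iUnion₂.2 ⟨s, hs, subset_convexHull ℝ _ (hN.nucleus_mem s hs)⟩⟩

end ShapeNerve

theorem mainTheorem2 {d : ℕ} (K : Geometry.SimplicialComplex ℝ (EuclideanSpace ℝ (Fin d)))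
    {ι : Type*} [Fintype ι] (p : ι → EuclideanSpace ℝ (Fin d))
    (N : ι → Set (Finset (EuclideanSpace ℝ (Fin d))))
    (hN : ∀ i, ShapeNerve.IsShapeNerve K (p i) (N i))
    (hclosed : ∀ i, IsClosed (ShapeNerve.region (N i)))
    (hconvex : ∀ i, Convex ℝ (ShapeNerve.region (N i))) :
    Nonempty ((ShapeNerve.shape N : Set (ι → ℝ)) ≃ₕ
      (⋃ i, ShapeNerve.region (N i) : Set (EuclideanSpace ℝ (Fin d)))) :=
  ShapeNerve.nonempty_homotopyEquiv_realization_nerve (fun i => (hN i).region_nonempty)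
    hclosed hconvex
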